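/- Let $d\in\mathbb N_0$ and let $\mathbb D^d=\{z\in\mathbb C^d: |z_i|<1,\ i=1,\dots,d\}$. An analytic function $f:\mathbb D^d\to\mathbb C$ with Taylor expansion $f(z)=\sum_k c_kz^k$ is called Schur--Agler if $\|f(T)\|\le 1$, where $f(T)=\sum_k c_kT^k$, for every $d$-tuple $T=(T_1,\dots,T_d)$ of commuting strict contractions ($\|T_i\|<1$) on a complex Hilbert space. For $p=\sum_k p_kz^k\in\mathbb C[z_1,\dots,z_d]$ put $\bar p(z)=\overline{p(\bar z)}$, so that $z^n\bar p(1/z)=\sum_k\overline{p_k}\,z^{n-k}$. A polynomial $p$ is an eventual Agler denominator of order $n\in\mathbb N_0^d$ if it has no zeros in $\mathbb D^d$ and $z^n\bar p(1/z)/p(z)$ is Schur--Agler (in particular, $n_i\ge\deg_ip$ for all $i$); it is an eventual Agler denominator if this holds for some $n\in\mathbb N_0^d$. Let $p\in\mathbb C[z_1,\dots,z_d]$ with $p(0)=1$, and write $p_r(z)=p(rz)$. Then there exists $r>0$ such that $p_r$ is an eventual Agler denominator. In fact, if $$p(z)=\det(I_{|n|}-KZ_n),\qquad Z_n=\bigoplus_{i=1}^d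 z_iI_{n_i},$$ for some $n=(n_1,\dots,n_d)\in\mathbb N_0^d$, $|n|=n_1+\dots+n_d$, and some $K\in\mathbb C^{|n|\times|n|}$ with operator norm $\|K\|$, then for every real $r$ with $0<r\le 1/\|K\|$ (every $r>0$ if $\|K\|=0$) the polynomial $p_r$ is an eventual Agler denominator of order $n$. -/

import Mathlib

universe u

/-- The open unit polydisk in `ℂ^d`. -/
def polydisk (d : ℕ) : Set (Fin d → ℂ) := {z | ∀ i, ‖z i‖ < 1}

/-- `c` is the family of Taylor coefficients at `0` of `f`, and the multiple power series
converges (absolutely, as every unconditional sum in `ℂ`) to `f` on the whole polydisk. Every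
analytic function on the polydisk has exactly one such family. -/
def IsTaylorFamily {d : ℕ} (c : (Fin d →₀ ℕ) → ℂ) (f : (Fin d → ℂ) → ℂ) : Prop :=
  ∀ z ∈ polydisk d, HasSum (fun k : Fin d →₀ ℕ => c k * ∏ i, z i ^ k i) (f z)

/-- `T^k = T_1^{k_1} ⋯ T_d^{k_d}` for a `d`-tuple of bounded operators. -/
def opMonomial {d : ℕ} {H : Type u} [NormedAddCommGroup H] [InnerProductSpace ℂ H]
    (T : Fin d → (H →L[ℂ] H)) (k : Fin d →₀ ℕ) : H →L[ℂ] H :=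
  (List.ofFn fun i => T i ^ k i).prod

/-- `S = f(T)`, where `f(T) = ∑_k c_k T^k` (convergence in operator norm) and the `c_k` are the
Taylor coefficients of `f` at `0`. -/
def IsValueAt {d : ℕ} {H : Type u} [NormedAddCommGroup H] [InnerProductSpace ℂ H]
    (f : (Fin d → ℂ) → ℂ) (T : Fin d → (H →L[ℂ] H)) (S : H →L[ℂ] H) : Prop :=
  ∃ c : (Fin d →₀ ℕ) → ℂ, IsTaylorFamily c f ∧
    HasSum (fun k : Fin d →₀ ℕ => c k • opMonomial T k) S

/-- The scalar Schur–Agler class on the polydisk: `f` is analytic on the polydisk, and `f(T)` has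
norm at most `1` for every `d`-tuple `T` of commuting strict contractions on a Hilbert space.
Values of `f` outside the polydisk are irrelevant. -/
structure IsSchurAgler {d : ℕ} (f : (Fin d → ℂ) → ℂ) : Prop where
  analytic : AnalyticOnNhd ℂ f (polydisk d)
  norm_le_one : ∀ (H : Type u) [NormedAddCommGroup H] [InnerProductSpace ℂ H] [CompleteSpace H]
    (T : Fin d → (H →L[ℂ] H)), (∀ i j, Commute (T i) (T j)) → (∀ i, ‖T i‖ < 1) →
      ∃ S : H →L[ℂ] H, IsValueAt f T S ∧ ‖S‖ ≤ 1

/-- A polynomial is semi-stable if it has no zeros in the open unit polydisk. -/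
def IsSemiStable {d : ℕ} (p : MvPolynomial (Fin d) ℂ) : Prop :=
  ∀ z ∈ polydisk d, MvPolynomial.eval z p ≠ 0

/-- The polynomial `z^n p̄(1/z) = ∑_k conj(p_k) z^{n-k}`, for `n ≥ deg p`. -/
noncomputable def reflection {d : ℕ} (n : Fin d →₀ ℕ) (p : MvPolynomial (Fin d) ℂ) :
    MvPolynomial (Fin d) ℂ :=
  ∑ k ∈ p.support, MvPolynomial.monomial (n - k) (starRingEnd ℂ (p.coeff k))

/-- `p` is an eventual Agler denominator of order `n`: `p` is semi-stable and `z^n p̄(1/z) / p(z)`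
is Schur–Agler. If that quotient is analytic on the polydisk then `z^n p̄(1/z)` is a polynomial,
i.e. `deg p ≤ n`; this is made explicit, so that the subtraction in `reflection` is the true one. -/
structure IsEventualAglerDenominatorOfOrder {d : ℕ} (n : Fin d →₀ ℕ)
    (p : MvPolynomial (Fin d) ℂ) : Prop where
  semiStable : IsSemiStable p
  degree_le : ∀ i, p.degreeOf i ≤ n i
  schurAgler : IsSchurAgler.{u}
    (fun z => MvPolynomial.eval z (reflection n p) / MvPolynomial.eval z p)

/-- `p` is an eventual Agler denominator (of some order). -/
def IsEventualAglerDenominator {d : ℕ} (p : MvPolynomial (Fin d) ℂ) : Prop :=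
  ∃ n : Fin d →₀ ℕ, IsEventualAglerDenominatorOfOrder.{u} n p

/-- `p_r(z) = p(r z)`. -/
noncomputable def dilate {d : ℕ} (r : ℝ) (p : MvPolynomial (Fin d) ℂ) :
    MvPolynomial (Fin d) ℂ :=
  MvPolynomial.bind₁ (fun i => MvPolynomial.C (r : ℂ) * MvPolynomial.X i) p

/-- The index set of the `|n| × |n|` matrices, split into `d` blocks of sizes `n_1, …, n_d`. -/
abbrev BlockIndex {d : ℕ} (n : Fin d →₀ ℕ) : Type := (i : Fin d) × Fin (n i)

/-- `Z_n = ⨁_i z_i I_{n_i}`, a diagonal matrix of coordinate variables. -/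
noncomputable def blockZ {d : ℕ} (n : Fin d →₀ ℕ) :
    Matrix (BlockIndex n) (BlockIndex n) (MvPolynomial (Fin d) ℂ) :=
  Matrix.diagonal fun s => MvPolynomial.X s.1

/-- The operator norm of a matrix, with respect to the Euclidean norm on `ℂ^{|n|}`. -/
noncomputable def opNorm {ι : Type} [Fintype ι] [DecidableEq ι] (K : Matrix ι ι ℂ) : ℝ :=
  ‖Matrix.toEuclideanCLM (n := ι) (𝕜 := ℂ) K‖

/-!
Rescaling reduces the statement to the case `‖K‖ ≤ 1`. Complete `K` to a unitary block matrix
`U = [[K, B], [C, D]]` and let `F = D + C Z (1 - K Z)⁻¹ B` be the transfer function, `Z = Z_n`.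
Taking determinants in `U* [[1 - K Z, B], [-C Z, D]] = [[K* - Z, 0], [B*, 1]]` gives
`det U* · det (1 - K Z) · det F = det (K* - Z)`, and `det (Z - K*)` is the reflection of
`det (1 - K Z)`; so the quotient of the reflection by the polynomial is a unimodular multiple of
`det F`. For commuting strict contractions `T` on `H`, the energy balance of the system shows that
`F(T)` is a contraction on `H^|n|`, and then `det F(T)` is a contraction on `H`, because it is the
action of `F(T)` on the top exterior power. Substituting operators is legitimate because the entries
of `(1 - K Z)⁻¹` have Taylor coefficients of modulus at most `1`: all identities hold in the algebra
of power series converging absolutely on the polydisk.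
-/

section AbsolutelyConvergentSeries

open MvPowerSeries

/-- The algebra of formal power series converging absolutely at every point of the open unit
polydisk. On it one can evaluate at any tuple of commuting strict contractions. -/
def polydiskSeries (σ : Type*) [Fintype σ] : Subalgebra ℂ (MvPowerSeries σ ℂ) where
  carrier := {c | ∀ z : σ → ℂ, (∀ i, ‖z i‖ < 1) →
    Summable fun k : σ →₀ ℕ => coeff k c * ∏ i, z i ^ k i}
  mul_mem' {a b} ha hb z hz := by
    classical
    refine (summable_sum_mul_antidiagonal_of_summable_mul
      (summable_mul_of_summable_norm (ha z hz).norm (hb z hz).norm)).congr fun k => ?_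
    rw [coeff_mul, Finset.sum_mul]
    refine Finset.sum_congr rfl fun x hx => ?_
    simp only [← Finset.HasAntidiagonal.mem_antidiagonal.1 hx, Finsupp.add_apply, pow_add,
      Finset.prod_mul_distrib]
    ring
  add_mem' {a b} ha hb z hz := ((ha z hz).add (hb z hz)).congr fun k => by rw [map_add, add_mul]
  algebraMap_mem' a z _ := by
    classical
    refine summable_of_ne_finset_zero (s := {0}) fun k hk => ?_
    rw [MvPowerSeries.algebraMap_apply, coeff_C, if_neg (by simpa using hk), zero_mul]

variable {σ : Type*} [Fintype σ]

theorem summable_prod_pow {z : σ → ℂ} (hz : ∀ i, ‖z i‖ < 1) :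
    Summable fun k : σ →₀ ℕ => ‖∏ i, z i ^ k i‖ := by
  classical
  simp only [norm_prod, norm_pow]
  refine summable_of_sum_le (c := ∏ i, ∑' j : ℕ, ‖z i‖ ^ j) (fun k => by positivity) fun s => ?_
  calc ∑ k ∈ s, ∏ i, ‖z i‖ ^ k i
      = ∑ f ∈ s.map Finsupp.equivFunOnFinite.toEmbedding, ∏ i, ‖z i‖ ^ f i := by simp
    _ ≤ ∑ f ∈ Fintype.piFinset fun i => s.image fun k => k i, ∏ i, ‖z i‖ ^ f i := by
        refine Finset.sum_le_sum_of_subset_of_nonneg (fun f hf => ?_) fun _ _ _ => by positivity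
        obtain ⟨k, hk, rfl⟩ := Finset.mem_map.1 hf
        exact Fintype.mem_piFinset.2 fun i => Finset.mem_image_of_mem _ hk
    _ = ∏ i, ∑ j ∈ s.image fun k => k i, ‖z i‖ ^ j := (Finset.prod_univ_sum _ _).symm
    _ ≤ ∏ i, ∑' j : ℕ, ‖z i‖ ^ j := by
        gcongr with i
        exact (summable_geometric_of_lt_one (norm_nonneg _) (hz i)).sum_le_tsum _
          fun _ _ => by positivity

theorem mem_polydiskSeries_of_norm_coeff_le {c : MvPowerSeries σ ℂ} {C : ℝ}
    (hc : ∀ k, ‖coeff k c‖ ≤ C) : c ∈ polydiskSeries σ := fun z hz => by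
  refine .of_norm <| ((summable_prod_pow hz).mul_left C).of_nonneg_of_le
    (fun _ => norm_nonneg _) fun k => ?_
  rw [norm_mul]
  gcongr
  exact hc k

namespace polydiskSeries

/-- The coordinate functions on the polydisk. -/
noncomputable def X (i : σ) : polydiskSeries σ :=
  ⟨MvPowerSeries.X i, mem_polydiskSeries_of_norm_coeff_le (C := 1) fun k => by
    classical
    rw [coeff_X]
    split_ifs <;> simp⟩

/-- Polynomials as absolutely convergent power series. -/
noncomputable def ofMvPolynomial : MvPolynomial σ ℂ →ₐ[ℂ] polydiskSeries σ :=
  MvPolynomial.aeval X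

variable {A : Type*} [NormedCommRing A]

theorem norm_prod_pow_le (t : σ → A) (k : σ → ℕ) :
    ‖∏ i, t i ^ k i‖ ≤ ‖(1 : A)‖ * ∏ i, ‖t i‖ ^ k i := by
  have norm_mul_pow_le (x a : A) (n : ℕ) : ‖x * a ^ n‖ ≤ ‖x‖ * ‖a‖ ^ n := by
    induction n with
    | zero => simp
    | succ n ih =>
      rw [pow_succ, pow_succ, ← mul_assoc, ← mul_assoc]
      exact (norm_mul_le _ _).trans (by gcongr)
  classical
  induction (Finset.univ : Finset σ) using Finset.induction_on with
  | empty => simp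
  | insert i s hi ih =>
    rw [Finset.prod_insert hi, Finset.prod_insert hi, mul_comm, mul_left_comm, mul_comm (_ ^ _)]
    exact (norm_mul_pow_le _ _ _).trans (by gcongr)

variable [NormedAlgebra ℂ A] {t : σ → A}

theorem summable_norm_coeff_smul (ht : ∀ i, ‖t i‖ < 1) (c : polydiskSeries σ) :
    Summable fun k => ‖coeff k c.1 • ∏ i, t i ^ k i‖ := by
  have hc := (c.2 (fun i => (‖t i‖ : ℂ)) (by simpa using ht)).norm
  refine (hc.mul_left ‖(1 : A)‖).of_nonneg_of_le (fun _ => norm_nonneg _) fun k => ?_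
  calc ‖coeff k c.1 • ∏ i, t i ^ k i‖
      ≤ ‖coeff k c.1‖ * (‖(1 : A)‖ * ∏ i, ‖t i‖ ^ k i) := by
        rw [norm_smul]
        gcongr
        exact norm_prod_pow_le t k
    _ = ‖(1 : A)‖ * ‖coeff k c.1 * ∏ i, (‖t i‖ : ℂ) ^ k i‖ := by
        simp only [norm_mul, norm_prod, norm_pow, Complex.norm_real, norm_norm]
        ring

variable [CompleteSpace A]

theorem tsum_coeff_mul_smul (ht : ∀ i, ‖t i‖ < 1) (a b : polydiskSeries σ) :
    ∑' k, coeff k (a * b).1 • ∏ i, t i ^ k i =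
      (∑' k, coeff k a.1 • ∏ i, t i ^ k i) * ∑' k, coeff k b.1 • ∏ i, t i ^ k i := by
  classical
  have ha := summable_norm_coeff_smul ht a
  have hb := summable_norm_coeff_smul ht b
  have hab := summable_mul_of_summable_norm ha hb
  rw [Summable.tsum_mul_tsum_eq_tsum_sum_antidiagonal ha.of_norm hb.of_norm hab]
  refine tsum_congr fun k => ?_
  rw [MulMemClass.coe_mul, coeff_mul, Finset.sum_smul]
  refine Finset.sum_congr rfl fun x hx => ?_
  simp only [← Finset.HasAntidiagonal.mem_antidiagonal.1 hx, Finsupp.add_apply, pow_add,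
    Finset.prod_mul_distrib, smul_mul_smul_comm]

/-- Evaluation of absolutely convergent power series at a tuple of strict contractions in a
commutative Banach algebra. -/
noncomputable def eval (t : σ → A) (ht : ∀ i, ‖t i‖ < 1) : polydiskSeries σ →ₐ[ℂ] A where
  toFun c := ∑' k, coeff k c.1 • ∏ i, t i ^ k i
  map_one' := by
    classical
    rw [tsum_eq_single 0 fun k hk => by simp [coeff_one, hk]]
    simp
  map_mul' := tsum_coeff_mul_smul ht
  map_zero' := by simp
  map_add' a b := by
    rw [← (summable_norm_coeff_smul ht a).of_norm.tsum_add
      (summable_norm_coeff_smul ht b).of_norm]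
    simp only [AddMemClass.coe_add, map_add, add_smul]
  commutes' a := by
    classical
    rw [tsum_eq_single 0 fun k hk => by simp [MvPowerSeries.algebraMap_apply, coeff_C, hk]]
    simp [Algebra.algebraMap_eq_smul_one]

theorem hasSum_eval (ht : ∀ i, ‖t i‖ < 1) (c : polydiskSeries σ) :
    HasSum (fun k => coeff k c.1 • ∏ i, t i ^ k i) (eval t ht c) :=
  (summable_norm_coeff_smul ht c).of_norm.hasSum

@[simp]
theorem eval_X (ht : ∀ i, ‖t i‖ < 1) (i : σ) : eval t ht (X i) = t i := by
  classical
  refine (hasSum_eval ht _).unique ?_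
  convert hasSum_single (Finsupp.single i 1) fun k hk => ?_ using 1
  · simp [X, Finsupp.single_apply, Finset.prod_ite_eq]
  · simp [X, coeff_X, hk]

theorem eval_ofMvPolynomial {z : σ → ℂ} (hz : ∀ i, ‖z i‖ < 1) (p : MvPolynomial σ ℂ) :
    eval z hz (ofMvPolynomial p) = MvPolynomial.eval z p := by
  have : (eval z hz).comp ofMvPolynomial = MvPolynomial.aeval z :=
    MvPolynomial.algHom_ext fun i => by simp [ofMvPolynomial]
  rw [← MvPolynomial.aeval_eq_eval, ← this, AlgHom.comp_apply]

theorem exists_operator_eval {d : ℕ} {H : Type*} [NormedAddCommGroup H] [InnerProductSpace ℂ H]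
    [CompleteSpace H] (T : Fin d → (H →L[ℂ] H)) (hcomm : ∀ i j, Commute (T i) (T j))
    (hT : ∀ i, ‖T i‖ < 1) :
    ∃ φ : polydiskSeries (Fin d) →ₐ[ℂ] (H →L[ℂ] H), (∀ i, φ (X i) = T i) ∧
      ∀ c : polydiskSeries (Fin d), HasSum (fun k => coeff k c.1 • opMonomial T k) (φ c) := by
  let S := Algebra.adjoin ℂ (Set.range T)
  have hS : IsMulCommutative S := Algebra.isMulCommutative_adjoin ℂ (by
    rintro _ ⟨i, rfl⟩ _ ⟨j, rfl⟩
    exact hcomm i j)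
  let _ : NormedCommRing S.topologicalClosure :=
    { (inferInstance : NormedRing S.topologicalClosure),
      S.commRingTopologicalClosure mul_comm' with }
  have _ : CompleteSpace S.topologicalClosure := S.isClosed_topologicalClosure.completeSpace_coe
  let t (i : Fin d) : S.topologicalClosure :=
    ⟨T i, S.le_topologicalClosure (Algebra.subset_adjoin ⟨i, rfl⟩)⟩
  have ht (i : Fin d) : ‖t i‖ < 1 := hT i
  refine ⟨S.topologicalClosure.val.comp (eval t ht), fun i => ?_, fun c => ?_⟩
  · simp [t]
  · have hsum := (hasSum_eval ht c).map S.topologicalClosure.val continuous_subtype_val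
    refine hsum.congr_fun fun k => ?_
    rw [Function.comp_apply, map_smul, opMonomial, ← List.prod_ofFn, map_list_prod, List.map_ofFn]
    rfl

end polydiskSeries

end AbsolutelyConvergentSeries

section ContractiveMatrices

open Matrix
open scoped Matrix.Module

theorem sum_pi_fin_succ {ι M : Type*} [Fintype ι] [AddCommMonoid M] {m : ℕ}
    (u : (Fin (m + 1) → ι) → M) :
    ∑ f, u f = ∑ a : ι, ∑ f : Fin m → ι, u (Fin.cons a f) := by
  rw [← Fintype.sum_prod_type', ← (Fin.consEquiv fun _ : Fin (m + 1) => ι).sum_comp]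
  rfl

variable {R H ι : Type*} [CommRing R] [SeminormedAddCommGroup H] [Module R H]
  [Fintype ι] [DecidableEq ι]

variable (H) in
/-- A matrix over `R` is contractive on the `R`-module `H` if it acts as a contraction on the
`ℓ²`-sum of copies of `H`. The main cases are complex matrices acting on `ℂ^ι`, and matrices of
power series acting on copies of a Hilbert space through evaluation at commuting operators. -/
def IsContractiveOn (F : Matrix ι ι R) : Prop :=
  ∀ x : ι → H, ∑ i, ‖(F • x) i‖ ^ 2 ≤ ∑ i, ‖x i‖ ^ 2

/-- The matrix of the `m`-th tensor power of the linear map with matrix `F`. -/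
def tensorPower (F : Matrix ι ι R) (m : ℕ) : Matrix (Fin m → ι) (Fin m → ι) R :=
  of fun f g => ∏ k, F (f k) (g k)

theorem tensorPower_succ_smul_cons (F : Matrix ι ι R) (m : ℕ)
    (x : (Fin (m + 1) → ι) → H) (a : ι) (f : Fin m → ι) :
    (tensorPower F (m + 1) • x) (Fin.cons a f) =
      (F • fun b => (tensorPower F m • fun g => x (Fin.cons b g)) f) a := by
  simp only [Matrix.Module.smul_apply, tensorPower, of_apply, Finset.smul_sum, smul_smul]
  simp [sum_pi_fin_succ, Fin.prod_univ_succ]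

theorem isContractiveOn_tensorPower {F : Matrix ι ι R} (hF : IsContractiveOn H F)
    (m : ℕ) : IsContractiveOn H (tensorPower F m) := by
  induction m with
  | zero => intro x; simp [tensorPower, Matrix.Module.smul_apply]
  | succ m ih =>
    intro x
    rw [sum_pi_fin_succ, sum_pi_fin_succ]
    simp only [tensorPower_succ_smul_cons]
    calc _ = ∑ f : Fin m → ι, ∑ a,
          ‖(F • fun b => (tensorPower F m • fun g => x (Fin.cons b g)) f) a‖ ^ 2 :=
          Finset.sum_comm
      _ ≤ ∑ f : Fin m → ι, ∑ b, ‖(tensorPower F m • fun g => x (Fin.cons b g)) f‖ ^ 2 :=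
          Finset.sum_le_sum fun f _ => hF _
      _ = ∑ b, ∑ f : Fin m → ι, ‖(tensorPower F m • fun g => x (Fin.cons b g)) f‖ ^ 2 :=
          Finset.sum_comm
      _ ≤ ∑ b, ∑ f : Fin m → ι, ‖x (Fin.cons b f)‖ ^ 2 := Finset.sum_le_sum fun b _ => ih _

theorem sum_prod_smul_sign_smul (F : Matrix ι ι R) (τ : Equiv.Perm ι) (h : H) :
    ∑ σ : Equiv.Perm ι, (∏ i, F (τ i) (σ i)) • Equiv.Perm.sign σ • h =
      Equiv.Perm.sign τ • F.det • h := by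
  have hdet := det_permute τ F
  rw [← det_transpose, det_apply'] at hdet
  simp only [Units.smul_def, ← Int.cast_smul_eq_zsmul R, smul_smul, ← Finset.sum_smul]
  rw [← hdet]
  simp [mul_comm]

-- A contractive `F` has contractive exterior powers. On the top one, spanned by the
-- antisymmetric tensor `∑ σ, sign σ • e_σ`, it is multiplication by `det F`.
theorem IsContractiveOn.norm_det_smul_le {F : Matrix ι ι R} (hF : IsContractiveOn H F) (h : H) :
    ‖F.det • h‖ ≤ ‖h‖ := by
  let e := (Fintype.equivFin ι).symm
  let word (σ : Equiv.Perm ι) (k : Fin (Fintype.card ι)) : ι := σ (e k)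
  have word_injective : Function.Injective word := fun σ τ h =>
    Equiv.ext fun i => by simpa [word] using congrFun h (e.symm i)
  let x : (Fin (Fintype.card ι) → ι) → H :=
    Function.extend word (fun σ => Equiv.Perm.sign σ • h) 0
  have hx (σ) : x (word σ) = Equiv.Perm.sign σ • h := word_injective.extend_apply _ _ σ
  have hx_zero {f} (hf : f ∉ Set.range word) : x f = 0 := Function.extend_apply' _ _ _ hf
  have hFx (τ) :
      (tensorPower F (Fintype.card ι) • x) (word τ) = Equiv.Perm.sign τ • F.det • h := by
    rw [← sum_prod_smul_sign_smul, Matrix.Module.smul_apply]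
    refine (Fintype.sum_of_injective word word_injective _ _
      (fun f hf => by rw [hx_zero hf, smul_zero]) fun σ => ?_).symm
    rw [hx, ← e.prod_comp]
    rfl
  have hcard : (Fintype.card (Equiv.Perm ι) : ℝ) * ‖F.det • h‖ ^ 2 ≤
      Fintype.card (Equiv.Perm ι) * ‖h‖ ^ 2 := by
    calc _ = ∑ τ, ‖(tensorPower F (Fintype.card ι) • x) (word τ)‖ ^ 2 := by simp [hFx]
      _ ≤ ∑ f, ‖(tensorPower F (Fintype.card ι) • x) f‖ ^ 2 := by
        refine (Finset.sum_map Finset.univ ⟨word, word_injective⟩ fun f =>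
          ‖(tensorPower F (Fintype.card ι) • x) f‖ ^ 2).symm.trans_le ?_
        exact Finset.sum_le_univ_sum_of_nonneg fun _ => by positivity
      _ ≤ ∑ f, ‖x f‖ ^ 2 := isContractiveOn_tensorPower hF _ x
      _ = ∑ σ, ‖x (word σ)‖ ^ 2 := (Fintype.sum_of_injective word word_injective _ _
          (fun f hf => by simp [hx_zero hf]) fun _ => rfl).symm
      _ = _ := by simp [hx]
  exact le_of_sq_le_sq (le_of_mul_le_mul_left hcard (by positivity)) (norm_nonneg _)

end ContractiveMatrices

section Resolvent

open Matrix MvPowerSeries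
open scoped Matrix.Module

variable {ι : Type*} [Fintype ι] [DecidableEq ι]

/-- The matrix `K Z`, where `Z` is the diagonal matrix with diagonal `z`. -/
def pencil {k R : Type*} [CommRing k] [CommRing R] [Algebra k R] (K : Matrix ι ι k) (z : ι → R) :
    Matrix ι ι R :=
  K.map (algebraMap k R) * diagonal z

theorem map_pencil {k R S : Type*} [CommRing k] [CommRing R] [Algebra k R] [CommRing S]
    [Algebra k S] (φ : R →ₐ[k] S) (K : Matrix ι ι k) (z : ι → R) :
    φ.mapMatrix (pencil K z) = pencil K fun s => φ (z s) := by
  ext i j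
  simp [pencil, mul_diagonal]

theorem pencil_smul {k R : Type*} [CommRing k] [CommRing R] [Algebra k R] (a : k)
    (K : Matrix ι ι k) (z : ι → R) : pencil K (fun s => a • z s) = pencil (a • K) z := by
  ext i j
  rw [pencil, pencil, mul_diagonal, mul_diagonal, map_apply, map_apply, Matrix.smul_apply,
    smul_eq_mul, map_mul, Algebra.smul_def, mul_left_comm, mul_assoc]

variable {σ : Type*} [Fintype σ]

theorem sum_norm_sq_coeff_X_mul [DecidableEq σ] (i : σ) (f : MvPowerSeries σ ℂ) (m : ℕ) :
    ∑ k ∈ Finset.finsuppAntidiag Finset.univ (m + 1), ‖coeff k (X i * f)‖ ^ 2 =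
      ∑ k ∈ Finset.finsuppAntidiag Finset.univ m, ‖coeff k f‖ ^ 2 := by
  have mem_shift (k : σ →₀ ℕ) :
      Finsupp.single i 1 + k ∈ Finset.finsuppAntidiag Finset.univ (m + 1) ↔
        k ∈ Finset.finsuppAntidiag Finset.univ m := by
    simp [Finset.sum_add_distrib, Finsupp.single_apply, add_comm 1]
  refine (Finset.sum_of_injOn (Finsupp.single i 1 + ·) (add_right_injective _).injOn
    (fun k hk => (mem_shift k).2 hk) (fun k hk hk' => ?_) fun k _ => ?_).symm
  · rw [X, coeff_monomial_mul, if_neg, norm_zero, zero_pow two_ne_zero]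
    intro hle
    obtain ⟨l, rfl⟩ := exists_add_of_le hle
    exact hk' ⟨l, (mem_shift l).1 hk, rfl⟩
  · rw [X, coeff_add_monomial_mul, one_mul]

theorem IsContractiveOn.sum_norm_sq_coeff_le [DecidableEq σ] {K : Matrix ι ι ℂ}
    (hK : IsContractiveOn ℂ K) {l : ι → σ} {b : ι → ℂ} {f : ι → MvPowerSeries σ ℂ}
    (hf : ∀ s, f s = C (b s) + ∑ t, C (K s t) * (X (l t) * f t)) (m : ℕ) :
    ∑ k ∈ Finset.finsuppAntidiag Finset.univ m, ∑ s, ‖coeff k (f s)‖ ^ 2 ≤ ∑ s, ‖b s‖ ^ 2 := by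
  induction m with
  | zero =>
    rw [Finset.finsuppAntidiag_zero, Finset.sum_singleton]
    refine Finset.sum_le_sum fun s _ => ?_
    rw [hf, map_add, map_sum]
    simp only [coeff_C_mul, coeff_zero_X_mul]
    simp
  | succ m ih =>
    calc _ ≤ ∑ k ∈ Finset.finsuppAntidiag Finset.univ (m + 1),
          ∑ t, ‖coeff k (X (l t) * f t)‖ ^ 2 := by
          refine Finset.sum_le_sum fun k hk => ?_
          have hk0 : k ≠ 0 := by
            rintro rfl
            simp at hk
          refine le_of_eq_of_le (Finset.sum_congr rfl fun s _ => ?_)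
            (hK fun t => coeff k (X (l t) * f t))
          rw [hf, map_add, map_sum, coeff_C, if_neg hk0, zero_add]
          simp only [coeff_C_mul, Matrix.Module.smul_apply, smul_eq_mul]
      _ = ∑ k ∈ Finset.finsuppAntidiag Finset.univ m, ∑ s, ‖coeff k (f s)‖ ^ 2 := by
          rw [Finset.sum_comm,
            Finset.sum_congr rfl fun t _ => sum_norm_sq_coeff_X_mul (l t) (f t) m, Finset.sum_comm]
      _ ≤ _ := ih

theorem IsContractiveOn.norm_coeff_resolvent_le_one {σ : Type*} [Finite σ] {K : Matrix ι ι ℂ}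
    (hK : IsContractiveOn ℂ K) {l : ι → σ} {G : Matrix ι ι (MvPowerSeries σ ℂ)}
    (hG : (1 - pencil K fun s => X (l s)) * G = 1) (i j : ι) (k : σ →₀ ℕ) :
    ‖coeff k (G i j)‖ ≤ 1 := by
  classical
  have _ := Fintype.ofFinite σ
  have hcol (s) : G s j = C ((1 : Matrix ι ι ℂ) s j) + ∑ t, C (K s t) * (X (l t) * G t j) := by
    rw [Matrix.sub_mul, Matrix.one_mul, sub_eq_iff_eq_add] at hG
    conv_lhs => rw [hG, pencil, Matrix.mul_assoc, add_comm, Matrix.add_apply, mul_apply]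
    simp [one_apply, apply_ite C, MvPowerSeries.algebraMap_apply, add_comm]
  have hbound := hK.sum_norm_sq_coeff_le hcol (∑ i, k i)
  rw [Finset.sum_eq_single (a := j) (by simp +contextual [one_apply]) (by simp), one_apply_eq,
    norm_one, one_pow] at hbound
  refine (sq_le_one_iff₀ (norm_nonneg _)).1 (le_trans ?_ hbound)
  calc _ ≤ ∑ s, ‖coeff k (G s j)‖ ^ 2 :=
        Finset.single_le_sum (f := fun s => ‖coeff k (G s j)‖ ^ 2)
          (fun _ _ => by positivity) (Finset.mem_univ i)
    _ ≤ _ := Finset.single_le_sum (f := fun k => ∑ s, ‖coeff k (G s j)‖ ^ 2)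
          (fun _ _ => by positivity) (by simp)

theorem IsContractiveOn.isUnit_det_one_sub_pencil {K : Matrix ι ι ℂ} (hK : IsContractiveOn ℂ K)
    (l : ι → σ) : IsUnit (1 - pencil K fun s => polydiskSeries.X (l s)).det := by
  set A : Matrix ι ι (MvPowerSeries σ ℂ) := 1 - pencil K fun s => X (l s) with hA
  have hdet : IsUnit A.det := by
    have hA0 : (constantCoeff (σ := σ) (R := ℂ)).mapMatrix A = 1 := by
      ext i j
      simp [hA, pencil, mul_diagonal, one_apply, apply_ite]
    rw [isUnit_iff_constantCoeff, RingHom.map_det, hA0, det_one]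
    exact isUnit_one
  have hG : A * A⁻¹ = 1 := mul_nonsing_inv _ hdet
  let G : Matrix ι ι (polydiskSeries σ) := of fun i j =>
    ⟨A⁻¹ i j, mem_polydiskSeries_of_norm_coeff_le (hK.norm_coeff_resolvent_le_one hG i j)⟩
  refine isUnit_det_of_right_inverse (B := G) ?_
  have val_injective : Function.Injective ((polydiskSeries σ).val.mapMatrix (m := ι)) :=
    Matrix.map_injective Subtype.val_injective
  apply val_injective
  rw [map_mul, map_sub, map_one, map_pencil]
  exact hG

end Resolvent

section TransferFunction

open Matrix
open scoped Matrix.Module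

variable {ι R H : Type*} [Fintype ι] [DecidableEq ι] [CommRing R]

/-- The transfer function `D + C Z (1 - K Z)⁻¹ B` of the system with block matrix
`[[K, B], [C, D]]`, where `Z` is an arbitrary matrix; it is meaningful if `1 - K Z` is
invertible. -/
noncomputable def transferFunction (K B C D Z : Matrix ι ι R) : Matrix ι ι R :=
  D + C * Z * (1 - K * Z)⁻¹ * B

theorem det_mul_det_transferFunction {K B C D K' B' C' D' Z : Matrix ι ι R}
    (hinv : fromBlocks K' B' C' D' * fromBlocks K B C D = 1) (hKZ : IsUnit (1 - K * Z).det) :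
    (fromBlocks K' B' C' D').det * ((1 - K * Z).det * (transferFunction K B C D Z).det) =
      (K' - Z).det := by
  have hprod : fromBlocks K' B' C' D' * fromBlocks (1 - K * Z) B (-(C * Z)) D =
      fromBlocks (K' - Z) 0 C' 1 := by
    rw [fromBlocks_multiply, ← fromBlocks_one, fromBlocks_inj] at hinv
    obtain ⟨h₁₁, h₁₂, h₂₁, h₂₂⟩ := hinv
    rw [fromBlocks_multiply, h₁₂, h₂₂]
    congr 1
    · calc K' * (1 - K * Z) + B' * -(C * Z) = K' - (K' * K + B' * C) * Z := by noncomm_ring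
        _ = K' - Z := by rw [h₁₁, Matrix.one_mul]
    · calc C' * (1 - K * Z) + D' * -(C * Z) = C' - (C' * K + D' * C) * Z := by noncomm_ring
        _ = C' := by rw [h₂₁, Matrix.zero_mul, sub_zero]
  let _ := invertibleOfIsUnitDet _ hKZ
  have hdet := congrArg det hprod
  rwa [det_mul, det_fromBlocks₁₁ (1 - K * Z), det_fromBlocks_zero₁₂, det_one, mul_one,
    invOf_eq_nonsing_inv, Matrix.neg_mul, Matrix.neg_mul, sub_neg_eq_add] at hdet

variable [SeminormedAddCommGroup H] [Module R H]

theorem fromBlocks_smul_sumElim (A B C D : Matrix ι ι R) (x y : ι → H) :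
    fromBlocks A B C D • Sum.elim x y = Sum.elim (A • x + B • y) (C • x + D • y) := by
  ext (i | i) <;> simp [Matrix.Module.smul_apply]

theorem isContractiveOn_transferFunction {K B C D Z : Matrix ι ι R}
    (hU : IsContractiveOn H (fromBlocks K B C D)) (hZ : IsContractiveOn H Z)
    (hKZ : IsUnit (1 - K * Z).det) : IsContractiveOn H (transferFunction K B C D Z) := by
  intro x
  let h : ι → H := ((1 - K * Z)⁻¹ * B) • x
  have hstate : K • Z • h + B • x = h := by
    have hinv := mul_nonsing_inv _ hKZ
    rw [Matrix.sub_mul, Matrix.one_mul, sub_eq_iff_eq_add'] at hinv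
    have hB : K * (Z * ((1 - K * Z)⁻¹ * B)) + B = (1 - K * Z)⁻¹ * B := by
      conv_rhs => rw [hinv, Matrix.add_mul, Matrix.one_mul]
      simp only [Matrix.mul_assoc]
    simp only [h, smul_smul, ← add_smul, hB]
  have houtput : C • Z • h + D • x = transferFunction K B C D Z • x := by
    simp only [h, smul_smul, ← add_smul, transferFunction, Matrix.mul_assoc, add_comm]
  have henergy := hU (Sum.elim (Z • h) x)
  rw [fromBlocks_smul_sumElim, hstate, houtput] at henergy
  simp only [Fintype.sum_sum_type, Sum.elim_inl, Sum.elim_inr] at henergy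
  linarith [hZ h]

theorem isContractiveOn_diagonal {z : ι → R} (hz : ∀ s (h : H), ‖z s • h‖ ≤ ‖h‖) :
    IsContractiveOn H (diagonal z) := fun x => by
  gcongr with i
  simpa [Matrix.Module.smul_apply, diagonal_apply] using hz i (x i)

end TransferFunction

section UnitaryDilation

open Matrix
open scoped Matrix.Module MatrixOrder ComplexOrder

variable {ι H : Type*} [Fintype ι] [DecidableEq ι]

theorem IsContractiveOn.exists_conjTranspose_mul_self_add_eq_one {K : Matrix ι ι ℂ}
    (hK : IsContractiveOn ℂ K) : ∃ C : Matrix ι ι ℂ, Kᴴ * K + Cᴴ * C = 1 := by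
  have star_dotProduct_self (v : ι → ℂ) : star v ⬝ᵥ v = ((∑ i, ‖v i‖ ^ 2 : ℝ) : ℂ) := by
    simp [dotProduct, Complex.conj_mul']
  have hpos : (1 - Kᴴ * K).PosSemidef := by
    refine .of_dotProduct_mulVec_nonneg
      (isHermitian_one.sub (isHermitian_conjTranspose_mul_self K)) fun x => ?_
    have hform : star x ⬝ᵥ (1 - Kᴴ * K) *ᵥ x =
        ((∑ i, ‖x i‖ ^ 2 - ∑ i, ‖(K *ᵥ x) i‖ ^ 2 : ℝ) : ℂ) := by
      rw [sub_mulVec, one_mulVec, dotProduct_sub, ← mulVec_mulVec, dotProduct_mulVec,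
        ← star_mulVec, star_dotProduct_self, star_dotProduct_self]
      push_cast
      rfl
    rw [hform]
    exact_mod_cast sub_nonneg.2 (hK x)
  obtain ⟨C, hC⟩ := CStarAlgebra.nonneg_iff_eq_star_mul_self.1 hpos.nonneg
  exact ⟨C, by rw [← star_eq_conjTranspose C, ← hC]; abel⟩

theorem IsContractiveOn.exists_unitary_dilation {K : Matrix ι ι ℂ} (hK : IsContractiveOn ℂ K) :
    ∃ B C D : Matrix ι ι ℂ, (fromBlocks K B C D)ᴴ * fromBlocks K B C D = 1 := by
  obtain ⟨C, hC⟩ := hK.exists_conjTranspose_mul_self_add_eq_one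
  let v : ι ⊕ ι → EuclideanSpace ℂ (ι ⊕ ι) :=
    Sum.elim (fun j => WithLp.toLp 2 (Sum.elim (fun i => K i j) fun i => C i j)) fun _ => 0
  have hv : Orthonormal ℂ ((Set.range (Sum.inl : ι → ι ⊕ ι)).domRestrict v) := by
    rw [orthonormal_iff_ite]
    rintro ⟨_, a, rfl⟩ ⟨_, b, rfl⟩
    have hab := congr($hC a b)
    simp only [Matrix.add_apply, mul_apply, conjTranspose_apply, one_apply] at hab
    simpa [v, PiLp.inner_apply, mul_comm, Subtype.ext_iff] using hab
  obtain ⟨b, hb⟩ := hv.exists_orthonormalBasis_extension_of_card_eq (by simp)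
  have hb_inl (j : ι) : b (Sum.inl j) = v (Sum.inl j) := hb _ ⟨j, rfl⟩
  refine ⟨of fun i j => b (Sum.inr j) (Sum.inl i), C,
    of fun i j => b (Sum.inr j) (Sum.inr i), ?_⟩
  have hU : fromBlocks K (of fun i j => b (Sum.inr j) (Sum.inl i)) C
      (of fun i j => b (Sum.inr j) (Sum.inr i)) = of fun i j => b j i := by
    ext (i | i) (j | j) <;> simp [hb_inl, v]
  rw [hU]
  ext i j
  have hij := orthonormal_iff_ite.1 b.orthonormal i j
  simpa [mul_apply, one_apply, PiLp.inner_apply, mul_comm] using hij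

variable [NormedAddCommGroup H] [InnerProductSpace ℂ H]

theorem sum_inner_matrix_smul (A : Matrix ι ι ℂ) (x y : ι → H) :
    ∑ i, inner ℂ (x i) ((A • y) i) = ∑ j, inner ℂ ((Aᴴ • x) j) (y j) := by
  simp only [Matrix.Module.smul_apply, inner_sum, sum_inner, inner_smul_left, inner_smul_right,
    conjTranspose_apply, RCLike.star_def, Complex.conj_conj]
  exact Finset.sum_comm

theorem sum_norm_sq_unitary_smul {U : Matrix ι ι ℂ} (hU : Uᴴ * U = 1) (x : ι → H) :
    ∑ i, ‖(U • x) i‖ ^ 2 = ∑ i, ‖x i‖ ^ 2 := by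
  have hinner := sum_inner_matrix_smul U (U • x) x
  rw [smul_smul, hU, one_smul] at hinner
  simp only [inner_self_eq_norm_sq_to_K] at hinner
  exact_mod_cast hinner

theorem isContractiveOn_map_unitary {R : Type*} [CommRing R] [Algebra ℂ R] [Module R H]
    [IsScalarTower ℂ R H] {U : Matrix ι ι ℂ} (hU : Uᴴ * U = 1) :
    IsContractiveOn H (U.map (algebraMap ℂ R)) := fun x => by
  have hsmul : U.map (algebraMap ℂ R) • x = U • x := by
    ext i
    simp [Matrix.Module.smul_apply]
  rw [hsmul, sum_norm_sq_unitary_smul hU]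

theorem norm_det_eq_one_of_conjTranspose_mul_self {U : Matrix ι ι ℂ} (hU : Uᴴ * U = 1) :
    ‖U.det‖ = 1 := by
  have hdet := congrArg (‖det ·‖) hU
  rw [det_mul, det_one, norm_mul, norm_one, det_conjTranspose, norm_star] at hdet
  nlinarith [norm_nonneg U.det]

end UnitaryDilation

section DeterminantalRepresentation

open Matrix

variable {ι k R : Type*} [Fintype ι] [DecidableEq ι] [CommRing k] [CommRing R] [Algebra k R]

theorem det_one_sub_eq_one_of_strictly_lower {α : Type*} [LinearOrder α] (w : ι → α)
    {N : Matrix ι ι R} (hN : ∀ s t, w s ≤ w t → N s t = 0) : (1 - N).det = 1 := by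
  have htri : (1 - N).BlockTriangular (OrderDual.toDual ∘ w) := fun s t (hst : w s < w t) => by
    rw [Matrix.sub_apply, one_apply_ne (ne_of_apply_ne w hst.ne), hN s t hst.le, sub_zero]
  rw [htri.det]
  refine Finset.prod_eq_one fun a _ => ?_
  have hblock : (1 - N).toSquareBlock (OrderDual.toDual ∘ w) a = 1 := by
    ext s t
    have hst : w s = w t := s.2.trans t.2.symm
    simp [toSquareBlock_def, one_apply, Subtype.ext_iff, hN s t hst.le]
  rw [hblock, det_one]

theorem det_one_sub_pencil_sub_vecMulVec {K : Matrix ι ι k} {b : ι → k} {z x : ι → R}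
    (hx : (1 - pencil K z) *ᵥ x = fun s => algebraMap k R (b s)) (c : ι → k) :
    (1 - pencil (K - vecMulVec b c) z).det =
      (1 - pencil K z).det * (1 + ∑ s, algebraMap k R (c s) * (z s * x s)) := by
  have hrank : 1 - pencil (K - vecMulVec b c) z =
      (1 - pencil K z) * (1 + vecMulVec x fun s => algebraMap k R (c s) * z s) := by
    rw [Matrix.mul_add, Matrix.mul_one, mul_vecMulVec, hx]
    ext s t
    simp only [pencil, Matrix.sub_apply, Matrix.add_apply, mul_diagonal, map_apply,
      vecMulVec_apply, map_sub, map_mul]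
    ring
  rw [hrank, det_mul, vecMulVec_eq Unit, det_one_add_replicateCol_mul_replicateRow]
  simp only [dotProduct, mul_assoc]

theorem eq_C_add_sum_monomial {σ : Type*} {p : MvPolynomial σ k} {S : Finset (σ →₀ ℕ)}
    [DecidableEq (σ →₀ ℕ)] (hp : p.support ⊆ insert 0 S) (hS : 0 ∉ S) :
    p = MvPolynomial.C (MvPolynomial.constantCoeff p) +
      ∑ t ∈ S, MvPolynomial.monomial t (p.coeff t) := by
  conv_lhs => rw [p.as_sum]
  rw [Finset.sum_subset hp fun t _ ht => by simp [MvPolynomial.notMem_support_iff.1 ht],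
    Finset.sum_insert hS]
  rfl

/-- The state matrix of a realization of polynomials whose monomials lie in a finite set `S` of
multi-indices: row `s` has a single `1`, at `pred s`, and vanishes when `pred s ∉ S`. -/
def predecessorMatrix (k : Type*) [CommRing k] {σ : Type*} [DecidableEq (σ →₀ ℕ)]
    {S : Finset (σ →₀ ℕ)} (pred : S → σ →₀ ℕ) : Matrix S S k :=
  of fun s t => if t.1 = pred s then 1 else 0

section predecessorMatrix

variable {σ : Type*} {S : Finset (σ →₀ ℕ)} {l : S → σ} {pred : S → σ →₀ ℕ}

theorem X_mul_monomial_pred (hl : ∀ s, Finsupp.single (l s) 1 + pred s = s.1) (s : S) :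
    MvPolynomial.X (l s) * MvPolynomial.monomial (pred s) (1 : k) =
      MvPolynomial.monomial s.1 1 := by
  rw [MvPolynomial.X, MvPolynomial.monomial_mul, hl, one_mul]

variable [DecidableEq (σ →₀ ℕ)]

theorem det_one_sub_pencil_predecessorMatrix
    (hl : ∀ s, Finsupp.single (l s) 1 + pred s = s.1) (z : S → R) :
    (1 - pencil (predecessorMatrix k pred) z).det = 1 := by
  refine det_one_sub_eq_one_of_strictly_lower (fun s => s.1.degree) fun s t hst => ?_
  have hne : t.1 ≠ pred s := by
    rintro heq
    rw [← hl s, map_add, heq, Finsupp.degree_single] at hst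
    omega
  simp [pencil, mul_diagonal, predecessorMatrix, hne]

theorem one_sub_pencil_predecessorMatrix_mulVec
    (hl : ∀ s, Finsupp.single (l s) 1 + pred s = s.1) (hpred : ∀ s, pred s ∈ S ↔ pred s ≠ 0) :
    (1 - pencil (predecessorMatrix k pred) fun s => MvPolynomial.X (l s)) *ᵥ
        (fun s => MvPolynomial.monomial (pred s) 1) =
      fun s => algebraMap k (MvPolynomial σ k) (if pred s = 0 then 1 else 0) := by
  ext1 s
  have hsum : ∑ t : S, (if t.1 = pred s then MvPolynomial.monomial t.1 (1 : k) else 0) =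
      if pred s ∈ S then MvPolynomial.monomial (pred s) 1 else 0 := by
    rw [Finset.sum_coe_sort S fun t => if t = pred s then MvPolynomial.monomial t (1 : k) else 0,
      Finset.sum_ite_eq']
  rw [sub_mulVec, one_mulVec, Pi.sub_apply, mulVec, dotProduct]
  simp only [pencil, mul_diagonal, map_apply, predecessorMatrix, of_apply,
    MvPolynomial.algebraMap_eq, apply_ite MvPolynomial.C, map_one, map_zero, ite_mul, one_mul,
    zero_mul, X_mul_monomial_pred hl, hsum, hpred]
  by_cases h0 : pred s = 0 <;> simp [h0]

end predecessorMatrix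

-- For each nonzero multi-index `s` in a box containing the support of `p`, pick a variable
-- `X (l s)` dividing `X ^ s`. The states `x s = X ^ s / X (l s)` then solve `(1 - K Z) x = b` with
-- a strictly triangular `K`, and `p = 1 + ∑ s, p_s (Z x)_s`.
theorem exists_eq_det_one_sub_pencil {σ : Type u} (p : MvPolynomial σ k)
    (hp : MvPolynomial.constantCoeff p = 1) :
    ∃ (ι : Type u) (_ : Fintype ι) (_ : DecidableEq ι) (l : ι → σ) (K : Matrix ι ι k),
      p = (1 - pencil K fun s => (MvPolynomial.X (l s) : MvPolynomial σ k)).det := by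
  classical
  let n : σ →₀ ℕ := p.support.sup id
  let S : Finset (σ →₀ ℕ) := (Finset.Iic n).erase 0
  have mem_S {t : σ →₀ ℕ} : t ∈ S ↔ t ≠ 0 ∧ t ≤ n := by simp [S]
  have hsupp : p.support ⊆ insert 0 S := fun t ht => by
    rw [Finset.insert_erase (Finset.mem_Iic.2 zero_le)]
    exact Finset.mem_Iic.2 (Finset.le_sup (f := id) ht)
  choose l hl using fun s : S => DFunLike.ne_iff.1 (mem_S.1 s.2).1
  let pred (s : S) : σ →₀ ℕ := s.1 - Finsupp.single (l s) 1
  have pred_add (s : S) : Finsupp.single (l s) 1 + pred s = s.1 :=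
    add_tsub_cancel_of_le (Finsupp.single_le_iff.2 (Nat.one_le_iff_ne_zero.2 (hl s)))
  have hpred (s : S) : pred s ∈ S ↔ pred s ≠ 0 :=
    mem_S.trans (and_iff_left (tsub_le_self.trans (mem_S.1 s.2).2))
  let b (s : S) : k := if pred s = 0 then 1 else 0
  refine ⟨S, inferInstance, inferInstance, l,
    predecessorMatrix k pred - vecMulVec b fun s => p.coeff s.1, ?_⟩
  rw [det_one_sub_pencil_sub_vecMulVec (one_sub_pencil_predecessorMatrix_mulVec pred_add hpred),
    det_one_sub_pencil_predecessorMatrix pred_add, one_mul]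
  simp only [X_mul_monomial_pred pred_add]
  conv_lhs => rw [eq_C_add_sum_monomial hsupp (Finset.notMem_erase _ _), hp, map_one]
  rw [← Finset.sum_coe_sort S]
  simp [MvPolynomial.algebraMap_eq, MvPolynomial.C_mul_monomial]

end DeterminantalRepresentation

section DeterminantalPolynomials

open Matrix
open scoped Matrix.Module ComplexConjugate

theorem isContractiveOn_of_opNorm_le_one {ι : Type} [Fintype ι] [DecidableEq ι] {K : Matrix ι ι ℂ}
    (hK : opNorm K ≤ 1) : IsContractiveOn ℂ K := fun x => by
  have hle := (toEuclideanCLM (n := ι) (𝕜 := ℂ) K).le_of_opNorm_le hK (WithLp.toLp 2 x)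
  rw [one_mul, toEuclideanCLM_toLp] at hle
  have hsq := pow_le_pow_left₀ (norm_nonneg _) hle 2
  rwa [EuclideanSpace.norm_sq_eq, EuclideanSpace.norm_sq_eq] at hsq

theorem opNorm_smul {ι : Type} [Fintype ι] [DecidableEq ι] (a : ℂ) (K : Matrix ι ι ℂ) :
    opNorm (a • K) = ‖a‖ * opNorm K := by
  rw [opNorm, map_smul, norm_smul, opNorm]

theorem exists_blockIndex_equiv {ι : Type*} [Finite ι] {d : ℕ} (l : ι → Fin d) :
    ∃ (n : Fin d →₀ ℕ) (e : BlockIndex n ≃ ι), ∀ s, l (e s) = s.1 :=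
  ⟨Finsupp.equivFunOnFinite.symm fun i => Nat.card {s // l s = i},
    (Equiv.sigmaCongrRight fun i => (Finite.equivFin {s // l s = i}).symm).trans
      (Equiv.sigmaFiberEquiv l),
    fun s => ((Finite.equivFin {t // l t = s.1}).symm s.2).2⟩

theorem degreeOf_det_le {ι σ R : Type*} [Fintype ι] [DecidableEq ι] [CommRing R]
    {M : Matrix ι ι (MvPolynomial σ R)} {i : σ} {b : ι → ℕ}
    (hM : ∀ s t, (M s t).degreeOf i ≤ b t) : M.det.degreeOf i ≤ ∑ t, b t := by
  rw [det_apply]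
  refine (MvPolynomial.degreeOf_sum_le _ _ _).trans (Finset.sup_le fun τ _ => ?_)
  have hprod : (∏ t, M (τ t) t).degreeOf i ≤ ∑ t, b t :=
    (MvPolynomial.degreeOf_prod_le _ _ _).trans (Finset.sum_le_sum fun t _ => hM (τ t) t)
  rcases Int.units_eq_one_or (Equiv.Perm.sign τ) with hτ | hτ
  · simpa [hτ] using hprod
  · simpa [hτ, MvPolynomial.degreeOf_neg] using hprod

variable {d : ℕ} {n : Fin d →₀ ℕ}

/-- The determinantal polynomial `det (I - K Z_n)`. -/
noncomputable def detPencil (n : Fin d →₀ ℕ) (K : Matrix (BlockIndex n) (BlockIndex n) ℂ) :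
    MvPolynomial (Fin d) ℂ :=
  (1 - pencil K fun s => (MvPolynomial.X s.1 : MvPolynomial (Fin d) ℂ)).det

theorem exists_eq_detPencil (p : MvPolynomial (Fin d) ℂ) (hp : MvPolynomial.eval 0 p = 1) :
    ∃ (n : Fin d →₀ ℕ) (K : Matrix (BlockIndex n) (BlockIndex n) ℂ), p = detPencil n K := by
  obtain ⟨ι, _, _, l, K, hK⟩ :=
    exists_eq_det_one_sub_pencil p (by rw [← hp, MvPolynomial.eval_zero])
  obtain ⟨n, e, he⟩ := exists_blockIndex_equiv l
  refine ⟨n, K.submatrix e e, ?_⟩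
  rw [hK, ← det_submatrix_equiv_self e, detPencil]
  congr 1
  ext1 s t
  simp [pencil, mul_diagonal, one_apply, he]

theorem map_detPencil {R : Type*} [CommRing R] [Algebra ℂ R] (φ : MvPolynomial (Fin d) ℂ →ₐ[ℂ] R)
    (K : Matrix (BlockIndex n) (BlockIndex n) ℂ) :
    φ (detPencil n K) = (1 - pencil K fun s => φ (MvPolynomial.X s.1)).det := by
  rw [detPencil, AlgHom.map_det, map_sub, map_one, map_pencil]

theorem eval_detPencil (K : Matrix (BlockIndex n) (BlockIndex n) ℂ) (z : Fin d → ℂ) :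
    MvPolynomial.eval z (detPencil n K) = (1 - K * diagonal fun s : BlockIndex n => z s.1).det := by
  rw [← MvPolynomial.aeval_eq_eval]
  refine (map_detPencil (MvPolynomial.aeval z) K).trans ?_
  simp only [MvPolynomial.aeval_X]
  rfl

theorem degreeOf_detPencil_le (K : Matrix (BlockIndex n) (BlockIndex n) ℂ) (i : Fin d) :
    (detPencil n K).degreeOf i ≤ n i := by
  have hcol (s t : BlockIndex n) :
      ((1 - pencil K fun s => (MvPolynomial.X s.1 : MvPolynomial (Fin d) ℂ)) s t).degreeOf i ≤
        if t.1 = i then 1 else 0 := by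
    rw [Matrix.sub_apply, pencil, mul_diagonal, map_apply, one_apply, ← map_one MvPolynomial.C,
      ← map_zero MvPolynomial.C, ← apply_ite MvPolynomial.C]
    refine (MvPolynomial.degreeOf_sub_le _ _ _).trans (max_le ?_ ?_)
    · rw [MvPolynomial.degreeOf_C]
      exact Nat.zero_le _
    · refine (MvPolynomial.degreeOf_C_mul_le _ _ _).trans_eq ?_
      simp [MvPolynomial.degreeOf_X, eq_comm]
  refine (degreeOf_det_le hcol).trans_eq ?_
  rw [Fintype.sum_sigma]
  simp [apply_ite Finset.card]

theorem dilate_detPencil (r : ℝ) (K : Matrix (BlockIndex n) (BlockIndex n) ℂ) :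
    dilate r (detPencil n K) = detPencil n ((r : ℂ) • K) := by
  rw [dilate, map_detPencil, detPencil]
  simp only [MvPolynomial.bind₁_X_right, ← MvPolynomial.smul_eq_C_mul, pencil_smul]

theorem eval_reflection {p : MvPolynomial (Fin d) ℂ} (hp : ∀ i, p.degreeOf i ≤ n i)
    {z : Fin d → ℂ} (hz : ∀ i, z i ≠ 0) :
    MvPolynomial.eval z (reflection n p) =
      (∏ i, z i ^ n i) * conj (MvPolynomial.eval (fun i => conj (z i)⁻¹) p) := by
  rw [reflection, map_sum, MvPolynomial.eval_eq', map_sum, Finset.mul_sum]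
  refine Finset.sum_congr rfl fun k hk => ?_
  rw [MvPolynomial.eval_monomial, Finsupp.prod_fintype _ _ fun _ => pow_zero _, map_mul, map_prod,
    mul_left_comm, ← Finset.prod_mul_distrib]
  congr 1
  refine Finset.prod_congr rfl fun i _ => ?_
  rw [map_pow, Complex.conj_conj, inv_pow, Finsupp.coe_tsub, Pi.sub_apply,
    pow_sub₀ _ (hz i) ((MvPolynomial.monomial_le_degreeOf i hk).trans (hp i))]

theorem reflection_detPencil (K : Matrix (BlockIndex n) (BlockIndex n) ℂ) :
    reflection n (detPencil n K) = (blockZ n - Kᴴ.map MvPolynomial.C).det := by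
  refine MvPolynomial.funext_set (fun _ => {0}ᶜ) (fun _ => ?_) fun z hz => ?_
  · exact (Set.finite_singleton 0).infinite_compl
  have hz0 (i) : z i ≠ 0 := hz i (Set.mem_univ i)
  let Z : Matrix (BlockIndex n) (BlockIndex n) ℂ := diagonal fun s => z s.1
  have hdetZ : ∏ i, z i ^ n i = Z.det := by
    rw [det_diagonal, Fintype.prod_sigma]
    simp
  have hZinv : Z * (diagonal fun s : BlockIndex n => conj (z s.1)⁻¹)ᴴ = 1 := by
    rw [diagonal_conjTranspose, diagonal_mul_diagonal, ← diagonal_one]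
    congr 1
    ext1 s
    simp [hz0]
  have heval : (MvPolynomial.eval z).mapMatrix (blockZ n - Kᴴ.map MvPolynomial.C) = Z - Kᴴ := by
    ext s t
    simp [Z, blockZ, diagonal_apply, apply_ite]
  rw [eval_reflection (degreeOf_detPencil_le K) hz0, eval_detPencil, hdetZ, starRingEnd_apply,
    ← det_conjTranspose, ← det_mul, RingHom.map_det, heval, conjTranspose_sub, conjTranspose_one,
    conjTranspose_mul, Matrix.mul_sub, Matrix.mul_one, ← Matrix.mul_assoc, hZinv, Matrix.one_mul]

end DeterminantalPolynomials

section SchurAglerQuotients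

open Matrix MvPowerSeries
open scoped Matrix.Module

variable {d : ℕ}

theorem isTaylorFamily_div {p q : MvPolynomial (Fin d) ℂ} (hp : IsSemiStable p)
    {c : polydiskSeries (Fin d)}
    (hc : c * polydiskSeries.ofMvPolynomial p = polydiskSeries.ofMvPolynomial q) :
    IsTaylorFamily (fun k => coeff k c.1)
      fun z => MvPolynomial.eval z q / MvPolynomial.eval z p := fun z (hz : ∀ i, ‖z i‖ < 1) => by
  have hcz := congrArg (polydiskSeries.eval z hz) hc
  rw [map_mul, polydiskSeries.eval_ofMvPolynomial, polydiskSeries.eval_ofMvPolynomial] at hcz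
  beta_reduce
  rw [← eq_div_of_mul_eq (hp z hz) hcz]
  exact polydiskSeries.hasSum_eval hz c

theorem isSchurAgler_div {p q : MvPolynomial (Fin d) ℂ} (hp : IsSemiStable p)
    {c : polydiskSeries (Fin d)}
    (hc : c * polydiskSeries.ofMvPolynomial p = polydiskSeries.ofMvPolynomial q)
    (hnorm : ∀ (H : Type u) [NormedAddCommGroup H] [InnerProductSpace ℂ H]
      [Module (polydiskSeries (Fin d)) H] [IsScalarTower ℂ (polydiskSeries (Fin d)) H],
      (∀ (i : Fin d) (h : H), ‖polydiskSeries.X i • h‖ ≤ ‖h‖) → ∀ h : H, ‖c • h‖ ≤ ‖h‖) :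
    IsSchurAgler.{u} fun z => MvPolynomial.eval z q / MvPolynomial.eval z p where
  analytic := ((AnalyticOnNhd.eval_mvPolynomial _).mono (Set.subset_univ _)).div
    ((AnalyticOnNhd.eval_mvPolynomial _).mono (Set.subset_univ _)) hp
  norm_le_one H _ _ _ T hcomm hT := by
    obtain ⟨φ, hφX, hφ⟩ := polydiskSeries.exists_operator_eval T hcomm hT
    refine ⟨φ c, ⟨_, isTaylorFamily_div hp hc, hφ c⟩, ?_⟩
    let _ : Module (polydiskSeries (Fin d)) H :=
      Module.compHom H (φ : polydiskSeries (Fin d) →+* (H →L[ℂ] H))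
    have _ : IsScalarTower ℂ (polydiskSeries (Fin d)) H :=
      ⟨fun a c h => congr($(map_smul φ a c) h)⟩
    refine (φ c).opNorm_le_bound zero_le_one fun h => ?_
    rw [one_mul]
    refine hnorm H (fun i h => ?_) h
    change ‖φ (polydiskSeries.X i) h‖ ≤ ‖h‖
    rw [hφX]
    exact (T i).le_of_opNorm_le_of_le (hT i).le le_rfl |>.trans_eq (one_mul _)

variable {n : Fin d →₀ ℕ} {K : Matrix (BlockIndex n) (BlockIndex n) ℂ}

theorem ofMvPolynomial_detPencil (K : Matrix (BlockIndex n) (BlockIndex n) ℂ) :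
    polydiskSeries.ofMvPolynomial (detPencil n K) =
      (1 - pencil K fun s => polydiskSeries.X s.1).det := by
  simp only [map_detPencil, polydiskSeries.ofMvPolynomial, MvPolynomial.aeval_X]

theorem ofMvPolynomial_reflection_detPencil (K : Matrix (BlockIndex n) (BlockIndex n) ℂ) :
    polydiskSeries.ofMvPolynomial (reflection n (detPencil n K)) =
      (diagonal (fun s : BlockIndex n => polydiskSeries.X s.1) -
        Kᴴ.map (algebraMap ℂ (polydiskSeries (Fin d)))).det := by
  rw [reflection_detPencil, AlgHom.map_det]
  congr 1
  ext1 s t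
  simp [blockZ, polydiskSeries.ofMvPolynomial, diagonal_apply, apply_ite]

theorem isSemiStable_detPencil (hK : IsContractiveOn ℂ K) : IsSemiStable (detPencil n K) :=
  fun z (hz : ∀ i, ‖z i‖ < 1) => by
    have hunit := (hK.isUnit_det_one_sub_pencil Sigma.fst).map (polydiskSeries.eval z hz)
    rw [← ofMvPolynomial_detPencil, polydiskSeries.eval_ofMvPolynomial] at hunit
    exact hunit.ne_zero

theorem exists_contractive_mul_eq_reflection (hK : IsContractiveOn ℂ K) :
    ∃ c : polydiskSeries (Fin d),
      c * polydiskSeries.ofMvPolynomial (detPencil n K) =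
        polydiskSeries.ofMvPolynomial (reflection n (detPencil n K)) ∧
      ∀ (H : Type u) [NormedAddCommGroup H] [InnerProductSpace ℂ H]
        [Module (polydiskSeries (Fin d)) H] [IsScalarTower ℂ (polydiskSeries (Fin d)) H],
        (∀ (i : Fin d) (h : H), ‖polydiskSeries.X i • h‖ ≤ ‖h‖) → ∀ h : H, ‖c • h‖ ≤ ‖h‖ := by
  obtain ⟨B, C, D, hU⟩ := hK.exists_unitary_dilation
  let toSeries := algebraMap ℂ (polydiskSeries (Fin d))
  let Z : Matrix (BlockIndex n) (BlockIndex n) (polydiskSeries (Fin d)) :=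
    diagonal fun s => polydiskSeries.X s.1
  let F := transferFunction (K.map toSeries) (B.map toSeries) (C.map toSeries) (D.map toSeries) Z
  let u : ℂ := (-1) ^ Fintype.card (BlockIndex n) * (fromBlocks K B C D)ᴴ.det
  have hu : ‖u‖ = 1 := by simp [u, norm_det_eq_one_of_conjTranspose_mul_self hU]
  have hKZ : IsUnit (1 - K.map toSeries * Z).det := hK.isUnit_det_one_sub_pencil Sigma.fst
  refine ⟨u • F.det, ?_, fun H _ _ _ _ hX h => ?_⟩
  · have hinv : ((fromBlocks K B C D)ᴴ * fromBlocks K B C D).map toSeries = 1 := by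
      rw [hU, Matrix.map_one _ (map_zero _) (map_one _)]
    rw [Matrix.map_mul, fromBlocks_conjTranspose, fromBlocks_map, fromBlocks_map] at hinv
    have hdet := det_mul_det_transferFunction hinv hKZ
    rw [← fromBlocks_map, ← fromBlocks_conjTranspose, ← RingHom.mapMatrix_apply,
      ← RingHom.map_det] at hdet
    rw [ofMvPolynomial_detPencil, ofMvPolynomial_reflection_detPencil, ← neg_sub (Kᴴ.map _),
      det_neg, ← hdet, Algebra.smul_def, pencil]
    simp only [u, map_mul, map_pow, map_neg, map_one, toSeries, Z, F]
    ring
  · rw [smul_assoc, norm_smul, hu, one_mul]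
    have hZ : IsContractiveOn H Z := isContractiveOn_diagonal fun s => hX s.1
    have hUmap : IsContractiveOn H (fromBlocks (K.map toSeries) (B.map toSeries) (C.map toSeries)
        (D.map toSeries)) := by
      rw [← fromBlocks_map]
      exact isContractiveOn_map_unitary hU
    exact (isContractiveOn_transferFunction hUmap hZ hKZ).norm_det_smul_le h

theorem isEventualAglerDenominatorOfOrder_detPencil (hK : IsContractiveOn ℂ K) :
    IsEventualAglerDenominatorOfOrder.{u} n (detPencil n K) := by
  obtain ⟨c, hc, hnorm⟩ := exists_contractive_mul_eq_reflection hK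
  have hp := isSemiStable_detPencil hK
  exact ⟨hp, degreeOf_detPencil_le K, isSchurAgler_div hp hc hnorm⟩

end SchurAglerQuotients

theorem mainTheorem9 (d : ℕ) (p : MvPolynomial (Fin d) ℂ) (hp : MvPolynomial.eval 0 p = 1) :
    (∃ r : ℝ, 0 < r ∧ IsEventualAglerDenominator.{u} (dilate r p)) ∧
    ∀ (n : Fin d →₀ ℕ) (K : Matrix (BlockIndex n) (BlockIndex n) ℂ),
      p = (1 - K.map MvPolynomial.C * blockZ n).det →
      ∀ r : ℝ, 0 < r → (opNorm K = 0 ∨ r ≤ 1 / opNorm K) →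
        IsEventualAglerDenominatorOfOrder.{u} n (dilate r p) := by
  have hdilate (n : Fin d →₀ ℕ) (K : Matrix (BlockIndex n) (BlockIndex n) ℂ)
      (hpK : p = detPencil n K) (r : ℝ) (hr : 0 < r) (hrK : opNorm K = 0 ∨ r ≤ 1 / opNorm K) :
      IsEventualAglerDenominatorOfOrder.{u} n (dilate r p) := by
    rw [hpK, dilate_detPencil]
    refine isEventualAglerDenominatorOfOrder_detPencil (isContractiveOn_of_opNorm_le_one ?_)
    rw [opNorm_smul, Complex.norm_real, Real.norm_of_nonneg hr.le]
    rcases hrK with hK | hrK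
    · simp [hK]
    · exact mul_le_of_le_div₀ zero_le_one (norm_nonneg _) hrK
  obtain ⟨n, K, hpK⟩ := exists_eq_detPencil p hp
  refine ⟨?_, hdilate⟩
  rcases eq_or_ne (opNorm K) 0 with hK | hK
  · exact ⟨1, one_pos, n, hdilate n K hpK 1 one_pos (.inl hK)⟩
  · have hr : 0 < 1 / opNorm K := one_div_pos.2 (hK.symm.lt_of_le (norm_nonneg _))
    exact ⟨_, hr, n, hdilate n K hpK _ hr (.inr le_rfl)⟩
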